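/- Let $\theta\in(0,1)$, $c(\theta):=-1/\log(1-\theta)$, and let $p(i,j):=\binom{i}{j}\theta^{i-j}(1-\theta)^j$ for $0\le j\le i$ and $p(i,j):=0$ for $j>i$ (binomial thinning; the number of participants in an election in which, in every round, each remaining participant independently leaves with probability $\theta$). Equip $\mathbb N_0^{\mathbb Z}$ with the product of the discrete topologies, let $(X_n)_{n\in\mathbb Z}$ be the coordinate process, and let $\delta_{\mathbf 0}$ be the point mass at the path that is identically $0$. For a sequence $(j_k)_{k\in\mathbb N}$ of positive integers let $\mathbf P_k$ be the probability measure on $\mathbb N_0^{\mathbb Z}$ under which $X_n=j_k$ for all $n\le -k+1$, almost surely, and $(X_n)_{n\ge -k+1}$ is a Markov chain with transition probabilities $p$. (i) $(\mathbf P_k)$ converges weakly, as $k\to\infty$, to a limit other than $\delta_{\mathbf 0}$ if and only if, for some $z\in\mathbb R$, $$\lim_{k\to\infty}\bigl(c(\theta)\log j_k-k\bigr)=z;$$ and $(\mathbf P_k)$ converges weakly to $\delta_{\mathbf 0}$ if and only if $c(\theta)\log j_k-k\to-\infty$. In the first case the limit $\mathbf P^z$ depends on the sequence $(j_k)$ only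 through $z$. (ii) For every $z\in\mathbb R$, under $\mathbf P^z$ the full sequence $(X_n)_{n\in\mathbb Z}$ is a Markov chain with transition probabilities $p$, and, $\mathbf P^z$-almost surely, $X_n>0$ for all sufficiently small $n$ and $$\lim_{n\to-\infty}\bigl(c(\theta)\log X_n+n\bigr)=z+1.$$ -/

import Mathlib

open MeasureTheory ProbabilityTheory Filter Topology

noncomputable section

namespace Election

/-- The transition probability `p(i, j)` of the participant-number chain: each of `i` participants
leaves with probability `θ`, independently of the others, and `j` of them remain.  (For `i = j = 0`
the value is `1`, for `j > i` it is `0`.) -/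
def transProb (θ : ℝ) (i j : ℕ) : ℝ :=
  if j ≤ i then (i.choose j : ℝ) * θ ^ (i - j) * (1 - θ) ^ j else 0

theorem transProb_nonneg {θ : ℝ} (hθ : θ ∈ Set.Ioo (0 : ℝ) 1) (i j : ℕ) :
    0 ≤ transProb θ i j := by
  have h0 : 0 ≤ θ := hθ.1.le
  have h1 : 0 ≤ 1 - θ := sub_nonneg.2 hθ.2.le
  unfold transProb
  split_ifs <;> positivity

theorem sum_transProb (θ : ℝ) (i : ℕ) :
    ∑ j ∈ Finset.range (i + 1), transProb θ i j = 1 := by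
  have h := add_pow (1 - θ) θ i
  rw [sub_add_cancel, one_pow] at h
  rw [h]
  refine Finset.sum_congr rfl fun j hj => ?_
  have hj' : j ≤ i := Nat.lt_succ_iff.1 (Finset.mem_range.1 hj)
  simp only [transProb, if_pos hj']
  ring

/-- The distribution `p(i, ·)` on `ℕ`. -/
def transPMF (θ : ℝ) (hθ : θ ∈ Set.Ioo (0 : ℝ) 1) (i : ℕ) : PMF ℕ :=
  PMF.ofFinset (fun j => ENNReal.ofReal (transProb θ i j)) (Finset.range (i + 1))
    (by rw [← ENNReal.ofReal_sum_of_nonneg fun j _ => transProb_nonneg hθ i j, sum_transProb,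
          ENNReal.ofReal_one])
    (by
      intro j hj
      have hj' : ¬ j ≤ i := fun h => hj (Finset.mem_range.2 (Nat.lt_succ_of_le h))
      simp [transProb, hj'])

/-- The transition kernel of the chain. -/
def transKernel (θ : ℝ) (hθ : θ ∈ Set.Ioo (0 : ℝ) 1) : Kernel ℕ ℕ :=
  Kernel.ofFunOfCountable fun i => (transPMF θ hθ i).toMeasure

instance transKernel_isMarkov (θ : ℝ) (hθ : θ ∈ Set.Ioo (0 : ℝ) 1) :
    IsMarkovKernel (transKernel θ hθ) :=
  ⟨fun i => PMF.toMeasure.isProbabilityMeasure (transPMF θ hθ i)⟩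

/-- The transition from time `n` to time `n + 1`, as a kernel from the histories up to time `n`. -/
def stepKernel (θ : ℝ) (hθ : θ ∈ Set.Ioo (0 : ℝ) 1) (n : ℕ) :
    Kernel ((_ : Finset.Iic n) → ℕ) ℕ :=
  (transKernel θ hθ).comap (fun h => h ⟨n, Finset.mem_Iic.2 le_rfl⟩) (measurable_pi_apply _)

instance stepKernel_isMarkov (θ : ℝ) (hθ : θ ∈ Set.Ioo (0 : ℝ) 1) (n : ℕ) :
    IsMarkovKernel (stepKernel θ hθ n) := by
  unfold stepKernel
  infer_instance

/-- The law on `ℕ → ℕ` of the chain with transition probabilities `transProb θ` that starts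
in `i` at time `0`. -/
def chainLaw (θ : ℝ) (hθ : θ ∈ Set.Ioo (0 : ℝ) 1) (i : ℕ) : Measure (ℕ → ℕ) :=
  Kernel.traj (X := fun _ => ℕ) (stepKernel θ hθ) 0 (fun _ => i)

instance chainLaw_isProb (θ : ℝ) (hθ : θ ∈ Set.Ioo (0 : ℝ) 1) (i : ℕ) :
    IsProbabilityMeasure (chainLaw θ hθ i) := by
  unfold chainLaw
  infer_instance

/-- Turns a path with time set `ℕ` into a two-sided path: time `0` becomes time `-k + 1`, and the
path is constant before. -/
def extendPath (k : ℕ) (x : ℕ → ℕ) : ℤ → ℕ :=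
  fun n => x (n + k - 1).toNat

theorem measurable_extendPath (k : ℕ) : Measurable (extendPath k) :=
  measurable_pi_lambda _ fun _ => measurable_pi_apply _

/-- The law on `ℤ → ℕ` of the two-sided process that equals `i` up to time `-k + 1` and is a
Markov chain with transition probabilities `transProb θ` from time `-k + 1` on.  The space `ℤ → ℕ`
carries the product of the discrete topologies, and `ProbabilityMeasure` the topology of weak
convergence. -/
def startLaw (θ : ℝ) (hθ : θ ∈ Set.Ioo (0 : ℝ) 1) (k i : ℕ) : ProbabilityMeasure (ℤ → ℕ) :=
  ⟨(chainLaw θ hθ i).map (extendPath k),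
    Measure.isProbabilityMeasure_map (measurable_extendPath k).aemeasurable⟩

/-- The point mass at the path that is identically `0`. -/
def zeroLaw : ProbabilityMeasure (ℤ → ℕ) :=
  ⟨Measure.dirac (fun _ => 0), Measure.dirac.isProbabilityMeasure⟩

/-- Under `P`, the coordinate process `(X_n)_{n ∈ ℤ}` is a Markov chain with transition
probabilities `transProb θ`: for all times `l ≤ n` and all states `i l, …, i (n + 1)`,
`P(X_l = i_l, …, X_{n+1} = i_{n+1}) = P(X_l = i_l, …, X_n = i_n) * p(i_n, i_{n+1})`. -/
def IsTwoSidedChain (θ : ℝ) (P : ProbabilityMeasure (ℤ → ℕ)) : Prop :=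
  ∀ (l n : ℤ), l ≤ n → ∀ i : ℤ → ℕ,
    (P : Measure (ℤ → ℕ)).real {x | ∀ s ∈ Set.Icc l (n + 1), x s = i s} =
      (P : Measure (ℤ → ℕ)).real {x | ∀ s ∈ Set.Icc l n, x s = i s} *
        transProb θ (i n) (i (n + 1))

/-- The constant `c(θ)`. -/
def c (θ : ℝ) : ℝ := -(1 / Real.log (1 - θ))

end Election

end

open scoped NNReal ENNReal

namespace Election

/-! Write q = 1 - θ and m_k = j_k q^k. Each participant survives n rounds with probability q^n, so
under P_k the variable X_l is binomial with j_k trials and success probability q^(l+k-1), once l ≥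
-k+1. If m_k → λ, the Poisson limit theorem makes X_l asymptotically Poisson with mean λ q^(l-1).
The Markov property carries this over to cylinders, and hence P_k converges weakly to a two-sided
chain with these marginals (`tendsto_startLaw`).

Such a chain exists (`exists_poisson_chain`): let independent Poisson numbers of participants leave
at the times n, with means λ q^(n-1) θ, and let X_n count all departures from time n on. For λ = 0
it is the zero path.

Conversely, weak convergence forces m_k to be bounded, and P_k(X_1 = 0) = (1 - q^k)^(j_k) is then
asymptotically exp(-m_k), so m_k converges (`exists_tendsto_of_tendsto_startLaw`). Since c(θ) log q
= -1, c(θ) log j_k - k equals c(θ) log m_k, which gives λ = exp(z / c(θ)).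

For the behaviour at -∞, X_n divided by its mean has variance 1 / E X_n. These variances are
summable along n → -∞, so the ratio tends to 1 almost surely (`ae_tendsto_div_intensity`). -/

/-! ### Binomial thinning and the one-sided chain. -/

/-- Composing two binomial thinnings gives a binomial thinning. -/
theorem sum_transProb_mul_transProb (s t : ℝ) (i b : ℕ) :
    ∑ a ∈ Finset.range (i + 1), transProb s i a * transProb t a b =
      transProb (1 - (1 - s) * (1 - t)) i b := by
  by_cases hbi : b ≤ i
  swap
  · have h0 : transProb (1 - (1 - s) * (1 - t)) i b = 0 := by simp [transProb, hbi]
    rw [h0]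
    refine Finset.sum_eq_zero fun a ha => ?_
    have : ¬ b ≤ a := by have := Finset.mem_range.1 ha; omega
    simp [transProb, this]
  obtain ⟨d, rfl⟩ := Nat.exists_eq_add_of_le hbi
  have hsplit : Finset.range (b + d + 1) = Finset.range (b + (d + 1)) := rfl
  rw [hsplit, Finset.sum_range_add]
  have hz : ∑ x ∈ Finset.range b, transProb s (b + d) x * transProb t x b = 0 := by
    refine Finset.sum_eq_zero fun a ha => ?_
    have : ¬ b ≤ a := by have := Finset.mem_range.1 ha; omega
    simp [transProb, this]
  rw [hz, zero_add]
  -- With a = b + e the sum over the intermediate state becomes this expansion, because 1 - (1 -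
  -- s)(1 - t) = (1 - s)t + s.
  have hbin := add_pow ((1 - s) * t) s d
  have hr : transProb (1 - (1 - s) * (1 - t)) (b + d) b =
      ((b + d).choose b : ℝ) * (((1 - s) * (1 - t)) ^ b) * ((1 - s) * t + s) ^ d := by
    rw [transProb, if_pos hbi, Nat.add_sub_cancel_left,
      show 1 - (1 - s) * (1 - t) = (1 - s) * t + s by ring,
      show 1 - ((1 - s) * t + s) = (1 - s) * (1 - t) by ring]
    ring
  rw [hr, hbin, Finset.mul_sum]
  refine Finset.sum_congr rfl fun e he => ?_
  have hed : e ≤ d := Nat.lt_succ_iff.1 (Finset.mem_range.1 he)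
  have hch : ((b + d).choose (b + e) : ℝ) * ((b + e).choose b : ℝ) =
      ((b + d).choose b : ℝ) * (d.choose e : ℝ) := by
    have := Nat.choose_mul (n := b + d) (k := b + e) (s := b) (by omega)
    rw [Nat.add_sub_cancel_left, Nat.add_sub_cancel_left] at this
    exact_mod_cast this
  rw [transProb, if_pos (by omega), transProb, if_pos (by omega), Nat.add_sub_cancel_left,
    show b + d - (b + e) = d - e by omega]
  calc _ = (((b + d).choose (b + e) : ℝ) * ((b + e).choose b : ℝ)) *
        (s ^ (d - e) * (1 - s) ^ (b + e) * (t ^ e * (1 - t) ^ b)) := by ring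
    _ = _ := by rw [hch, mul_pow, mul_pow, pow_add]; ring

theorem transKernel_singleton {θ : ℝ} (hθ : θ ∈ Set.Ioo (0 : ℝ) 1) (a b : ℕ) :
    transKernel θ hθ a {b} = ENNReal.ofReal (transProb θ a b) := by
  change (transPMF θ hθ a).toMeasure {b} = _
  rw [PMF.toMeasure_apply_singleton _ _ (MeasurableSet.singleton b)]
  rfl

/-- The Markov property of the one-sided chain. -/
theorem chainLaw_markov {θ : ℝ} (hθ : θ ∈ Set.Ioo (0 : ℝ) 1) (j n a b : ℕ)
    {B : Set ((_ : Finset.Iic n) → ℕ)} (hB : MeasurableSet B)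
    (ha : ∀ u ∈ B, u ⟨n, Finset.mem_Iic.2 le_rfl⟩ = a) :
    (chainLaw θ hθ j).real {x | Preorder.frestrictLe n x ∈ B ∧ x (n + 1) = b} =
      (chainLaw θ hθ j).real {x | Preorder.frestrictLe n x ∈ B} * transProb θ a b := by
  have hmap := Kernel.partialTraj_compProd_eq_map_traj (X := fun _ => ℕ) (κ := stepKernel θ hθ)
    (Nat.zero_le n) (x₀ := fun _ => j)
  have hproj := Kernel.traj_map_frestrictLe_apply (X := fun _ => ℕ) (κ := stepKernel θ hθ) 0 n
    (fun _ => j)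
  have hS : MeasurableSet (B ×ˢ ({b} : Set ℕ)) := hB.prod (MeasurableSet.singleton b)
  have h1 : chainLaw θ hθ j {x | Preorder.frestrictLe n x ∈ B ∧ x (n + 1) = b} =
      ((chainLaw θ hθ j).map (fun x ↦ (Preorder.frestrictLe n x, x (n + 1))))
        (B ×ˢ ({b} : Set ℕ)) := by
    rw [Measure.map_apply (by fun_prop) hS]
    rfl
  have h2 : chainLaw θ hθ j {x | Preorder.frestrictLe n x ∈ B} =
      ((chainLaw θ hθ j).map (Preorder.frestrictLe n)) B := by
    rw [Measure.map_apply (by fun_prop) hB]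
    rfl
  have h3 : chainLaw θ hθ j {x | Preorder.frestrictLe n x ∈ B ∧ x (n + 1) = b} =
      chainLaw θ hθ j {x | Preorder.frestrictLe n x ∈ B} * ENNReal.ofReal (transProb θ a b) := by
    rw [h1, h2]
    unfold chainLaw
    rw [← hmap, hproj, Measure.compProd_apply_prod hB (MeasurableSet.singleton b)]
    rw [setLIntegral_congr_fun (g := fun _ => ENNReal.ofReal (transProb θ a b)) hB]
    · rw [setLIntegral_const, mul_comm]
    · intro u hu
      change transKernel θ hθ (u ⟨n, _⟩) {b} = _
      rw [ha u hu, transKernel_singleton]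
  rw [measureReal_def, h3, ENNReal.toReal_mul, ENNReal.toReal_ofReal (transProb_nonneg hθ a b),
    measureReal_def]

theorem chainLaw_marginal_succ {θ : ℝ} (hθ : θ ∈ Set.Ioo (0 : ℝ) 1) (j n a b : ℕ) :
    (chainLaw θ hθ j).real {x | x n = a ∧ x (n + 1) = b} =
      (chainLaw θ hθ j).real {x | x n = a} * transProb θ a b :=
  chainLaw_markov hθ j n a b
    (B := {u | u ⟨n, Finset.mem_Iic.2 le_rfl⟩ = a})
    (measurable_pi_apply (X := fun _ : Finset.Iic n => ℕ) _ (MeasurableSet.singleton a))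
    (fun _ h => h)

theorem chainLaw_zero {θ : ℝ} (hθ : θ ∈ Set.Ioo (0 : ℝ) 1) (j b : ℕ) :
    (chainLaw θ hθ j).real {x | x 0 = b} = if b = j then 1 else 0 := by
  have hproj := Kernel.traj_map_frestrictLe_apply (X := fun _ => ℕ) (κ := stepKernel θ hθ) 0 0
    (fun _ => j)
  rw [Kernel.partialTraj_self, Kernel.id_apply] at hproj
  have hB : MeasurableSet {u : (_ : Finset.Iic 0) → ℕ | u ⟨0, Finset.mem_Iic.2 le_rfl⟩ = b} :=
    measurable_pi_apply (X := fun _ : Finset.Iic 0 => ℕ) _ (MeasurableSet.singleton b)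
  have h2 : chainLaw θ hθ j {x | x 0 = b} =
      ((chainLaw θ hθ j).map (Preorder.frestrictLe 0))
        {u : (_ : Finset.Iic 0) → ℕ | u ⟨0, Finset.mem_Iic.2 le_rfl⟩ = b} := by
    rw [Measure.map_apply (by fun_prop) hB]
    rfl
  rw [measureReal_def, h2]
  unfold chainLaw
  rw [hproj, Measure.dirac_apply' _ hB]
  by_cases h : b = j
  · simp [h]
  · simp [h, Ne.symm h]

/-- Total probability over a finite set that carries X; it supplies the Chapman–Kolmogorov sum in
`chainLaw_marginal`. -/
theorem measureReal_eq_sum_inter {Ω : Type*} [MeasurableSpace Ω] (μ : Measure Ω)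
    [IsFiniteMeasure μ] {X : Ω → ℕ} (hX : Measurable X) (F : Finset ℕ)
    (hF : ∀ a ∉ F, μ.real {ω | X ω = a} = 0) {A : Set Ω} (hA : MeasurableSet A) :
    μ.real A = ∑ a ∈ F, μ.real ({ω | X ω = a} ∩ A) := by
  have hnull : ∀ᵐ ω ∂μ, X ω ∈ F := by
    have h : ∀ a : ℕ, ∀ᵐ ω ∂μ, a ∉ F → X ω ≠ a := by
      intro a
      by_cases ha : a ∈ F
      · simp [ha]
      · have h0 := (measureReal_eq_zero_iff).1 (hF a ha)
        simpa [ha, ae_iff] using h0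
    filter_upwards [ae_all_iff.2 h] with ω hω
    by_contra hc
    exact hω (X ω) hc rfl
  have hae : A =ᵐ[μ] ⋃ a ∈ F, ({ω | X ω = a} ∩ A) := by
    filter_upwards [hnull] with ω hω
    apply propext
    change ω ∈ A ↔ ω ∈ ⋃ a ∈ F, ({ω | X ω = a} ∩ A)
    simp [hω]
  rw [measureReal_congr hae]
  refine measureReal_biUnion_finset (fun a _ a' _ hne => ?_) fun a _ =>
    (hX (MeasurableSet.singleton a)).inter hA
  exact Set.disjoint_left.2 fun x hx hx' => hne (hx.1.symm.trans hx'.1)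

theorem chainLaw_marginal {θ : ℝ} (hθ : θ ∈ Set.Ioo (0 : ℝ) 1) (j n b : ℕ) :
    (chainLaw θ hθ j).real {x | x n = b} = transProb (1 - (1 - θ) ^ n) j b := by
  have hmeas : ∀ m a, MeasurableSet {x : ℕ → ℕ | x m = a} := fun m a =>
    measurable_pi_apply (X := fun _ : ℕ => ℕ) m (MeasurableSet.singleton a)
  induction n generalizing b with
  | zero =>
    rw [chainLaw_zero]
    rcases lt_trichotomy b j with h | h | h
    · simp [transProb, h.ne, h.le, Nat.sub_ne_zero_of_lt h]
    · simp [transProb, h]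
    · simp [transProb, h.ne', not_le.2 h]
  | succ n ih =>
    have hfin : (chainLaw θ hθ j).real {x | x (n + 1) = b} =
        ∑ a ∈ Finset.range (j + 1), (chainLaw θ hθ j).real {x | x n = a ∧ x (n + 1) = b} := by
      refine measureReal_eq_sum_inter (chainLaw θ hθ j) (X := fun x => x n)
        (measurable_pi_apply n) (Finset.range (j + 1)) ?_ (hmeas (n + 1) b)
      intro a ha
      have : ¬ a ≤ j := by simpa using ha
      rw [ih a, transProb, if_neg this]
    rw [hfin]
    simp_rw [chainLaw_marginal_succ, ih]
    rw [sum_transProb_mul_transProb, sub_sub_cancel, pow_succ]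

/-! ### Marginals and Markov property of the two-sided starting laws. -/

theorem measurableSet_coord (m : ℤ) (a : ℕ) : MeasurableSet {x : ℤ → ℕ | x m = a} :=
  measurable_pi_apply (X := fun _ : ℤ => ℕ) m (MeasurableSet.singleton a)

theorem measurableSet_cylinder (l n : ℤ) (i : ℤ → ℕ) :
    MeasurableSet {x : ℤ → ℕ | ∀ s ∈ Set.Icc l n, x s = i s} := by
  have : {x : ℤ → ℕ | ∀ s ∈ Set.Icc l n, x s = i s} = ⋂ s ∈ Set.Icc l n, {x | x s = i s} := by
    ext x; simp
  rw [this]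
  exact MeasurableSet.biInter (Set.to_countable _) fun s _ => measurableSet_coord s (i s)

theorem startLaw_real_apply {θ : ℝ} (hθ : θ ∈ Set.Ioo (0 : ℝ) 1) (k j : ℕ) {A : Set (ℤ → ℕ)}
    (hA : MeasurableSet A) :
    (startLaw θ hθ k j : Measure (ℤ → ℕ)).real A =
      (chainLaw θ hθ j).real (extendPath k ⁻¹' A) := by
  change ((chainLaw θ hθ j).map (extendPath k)).real A = _
  rw [measureReal_def, Measure.map_apply (measurable_extendPath k) hA, measureReal_def]

/-- The truncation `toNat` also covers the constant stretch: there the exponent is 0, and thinning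
with parameter 0 is the point mass at `j`. -/
theorem startLaw_marginal {θ : ℝ} (hθ : θ ∈ Set.Ioo (0 : ℝ) 1) (k j : ℕ) (l : ℤ) (b : ℕ) :
    (startLaw θ hθ k j : Measure (ℤ → ℕ)).real {x | x l = b} =
      transProb (1 - (1 - θ) ^ (l + k - 1).toNat) j b := by
  rw [startLaw_real_apply hθ k j (measurableSet_coord l b), ← chainLaw_marginal hθ]
  rfl

theorem startLaw_markov {θ : ℝ} (hθ : θ ∈ Set.Ioo (0 : ℝ) 1) (k j : ℕ) {l n : ℤ} (hln : l ≤ n)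
    (hl : 0 ≤ l + k - 1) (i : ℤ → ℕ) :
    (startLaw θ hθ k j : Measure (ℤ → ℕ)).real {x | ∀ s ∈ Set.Icc l (n + 1), x s = i s} =
      (startLaw θ hθ k j : Measure (ℤ → ℕ)).real {x | ∀ s ∈ Set.Icc l n, x s = i s} *
        transProb θ (i n) (i (n + 1)) := by
  rw [startLaw_real_apply hθ k j (measurableSet_cylinder l (n + 1) i),
    startLaw_real_apply hθ k j (measurableSet_cylinder l n i)]
  set N : ℕ := (n + k - 1).toNat with hN
  have hNn : (N : ℤ) = n + k - 1 := Int.toNat_of_nonneg (by omega)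
  -- The cylinder in one-sided time: index s stands for time s - k + 1, and times before `l` stay
  -- free.
  let B : Set ((_ : Finset.Iic N) → ℕ) :=
    ⋂ s : Finset.Iic N, {u | l ≤ (s : ℕ) - k + 1 → u s = i ((s : ℕ) - k + 1)}
  have hB : MeasurableSet B := by
    refine MeasurableSet.iInter fun s => ?_
    by_cases h : l ≤ (s : ℕ) - k + 1
    · simp only [h, true_imp_iff]
      exact measurable_pi_apply (X := fun _ : Finset.Iic N => ℕ) s (MeasurableSet.singleton _)
    · simp [h]
  have key : ∀ x : ℕ → ℕ, Preorder.frestrictLe (π := fun _ => ℕ) N x ∈ B ↔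
      ∀ s ∈ Set.Icc l n, extendPath k x s = i s := by
    intro x
    simp only [B, Set.mem_iInter, Set.mem_ofPred_eq, Preorder.frestrictLe_apply, Set.mem_Icc,
      Subtype.forall, Finset.mem_Iic, extendPath]
    constructor
    · rintro h s ⟨h1, h2⟩
      have e : ((s + k - 1).toNat : ℤ) = s + k - 1 := Int.toNat_of_nonneg (by omega)
      have := h (s + k - 1).toNat (by omega) (by omega)
      rw [this]
      congr 1
      omega
    · intro h s hs h1
      have := h ((s : ℕ) - k + 1) ⟨h1, by omega⟩
      rw [← this]
      congr 1
      omega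
  have hmk := chainLaw_markov hθ j N (i n) (i (n + 1)) hB (by
    intro u hu
    have := Set.mem_iInter.1 hu ⟨N, Finset.mem_Iic.2 le_rfl⟩
    simp only [Set.mem_ofPred_eq] at this
    rw [this (by omega)]
    congr 1
    omega)
  have e1 : extendPath k ⁻¹' {x | ∀ s ∈ Set.Icc l n, x s = i s} =
      {x | Preorder.frestrictLe (π := fun _ => ℕ) N x ∈ B} := by
    ext x; exact (key x).symm
  have e2 : extendPath k ⁻¹' {x | ∀ s ∈ Set.Icc l (n + 1), x s = i s} =
      {x | Preorder.frestrictLe (π := fun _ => ℕ) N x ∈ B ∧ x (N + 1) = i (n + 1)} := by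
    ext x
    have hlast : x (N + 1) = extendPath k x (n + 1) := by
      simp only [extendPath]; congr 1; omega
    simp only [Set.mem_preimage, Set.mem_ofPred_eq, key, hlast, Set.mem_Icc]
    constructor
    · exact fun h => ⟨fun s hs => h s ⟨hs.1, by omega⟩, h (n + 1) ⟨by omega, le_rfl⟩⟩
    · rintro ⟨h1, h2⟩ s ⟨hs1, hs2⟩
      rcases eq_or_lt_of_le hs2 with rfl | hs
      · exact h2
      · exact h1 s ⟨hs1, by omega⟩
  rw [e1, e2, hmk]

/-! ### Poisson weights, their moments, and the Poisson limit theorem. -/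

/-- Poisson weights. -/
noncomputable def poissonWeight (r : ℝ) (n : ℕ) : ℝ := Real.exp (-r) * r ^ n / n.factorial

theorem poissonWeight_nonneg {r : ℝ} (hr : 0 ≤ r) (n : ℕ) : 0 ≤ poissonWeight r n := by
  unfold poissonWeight; positivity

theorem poissonMeasure_real_eq (r : ℝ≥0) (n : ℕ) :
    (poissonMeasure r).real {n} = poissonWeight r n :=
  poissonMeasure_real_singleton r n

theorem hasSum_poissonWeight {r : ℝ} (hr : 0 ≤ r) : HasSum (poissonWeight r) 1 :=
  hasSum_one_poissonMeasure ⟨r, hr⟩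

/-- Shifting the index by one with this identity lowers a factorial moment by one order; the mean
and the variance below both come from it. -/
theorem succ_mul_poissonWeight_succ (r : ℝ) (n : ℕ) :
    ((n + 1 : ℕ) : ℝ) * poissonWeight r (n + 1) = r * poissonWeight r n := by
  unfold poissonWeight
  rw [Nat.factorial_succ]
  push_cast
  field_simp
  ring

theorem hasSum_mean_poissonWeight {r : ℝ} (hr : 0 ≤ r) :
    HasSum (fun n : ℕ => (n : ℝ) * poissonWeight r n) r := by
  have h := (hasSum_poissonWeight hr).mul_left r
  rw [mul_one] at h
  simp_rw [← succ_mul_poissonWeight_succ] at h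
  have := (hasSum_nat_add_iff (f := fun n : ℕ => (n : ℝ) * poissonWeight r n) 1).1 h
  simpa using this

theorem hasSum_mul_pred_poissonWeight {r : ℝ} (hr : 0 ≤ r) :
    HasSum (fun n : ℕ => (n : ℝ) * (n - 1) * poissonWeight r n) (r ^ 2) := by
  have h := (hasSum_mean_poissonWeight hr).mul_left r
  have h' : HasSum (fun n : ℕ => (((n + 1 : ℕ) : ℝ)) * (((n + 1 : ℕ) : ℝ) - 1) *
      poissonWeight r (n + 1)) (r ^ 2) := by
    rw [sq]
    convert! h using 2 with n
    have := succ_mul_poissonWeight_succ r n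
    push_cast at this ⊢
    linear_combination (n : ℝ) * this
  have := (hasSum_nat_add_iff
    (f := fun n : ℕ => (n : ℝ) * (n - 1) * poissonWeight r n) 1).1 h'
  simpa using this

theorem hasSum_variance_poissonWeight {r : ℝ} (hr : 0 ≤ r) :
    HasSum (fun n : ℕ => ((n : ℝ) - r) ^ 2 * poissonWeight r n) r := by
  have h := ((hasSum_mul_pred_poissonWeight hr).add
    ((hasSum_mean_poissonWeight hr).mul_left (1 - 2 * r))).add
    ((hasSum_poissonWeight hr).mul_left (r ^ 2))
  convert! h using 2 with n
  · ring
  · ring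

/-- Poisson splitting: those who leave and those who stay in a Poisson population are independent
Poisson. This is why Poisson marginals are compatible with the transition probabilities. -/
theorem poissonWeight_mul_poissonWeight (r θ : ℝ) (d j : ℕ) :
    poissonWeight (r * θ) d * poissonWeight (r * (1 - θ)) j =
      poissonWeight r (d + j) * transProb θ (d + j) j := by
  unfold poissonWeight
  rw [transProb, if_pos (Nat.le_add_left j d), Nat.add_sub_cancel,
    show -r = -(r * θ) + -(r * (1 - θ)) by ring, Real.exp_add]
  have h := Nat.add_choose_mul_factorial_mul_factorial d j
  have h' : ((d + j).choose j : ℝ) * d.factorial * j.factorial = (d + j).factorial := by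
    exact_mod_cast h
  have hd : (d.factorial : ℝ) ≠ 0 := by positivity
  have hj : (j.factorial : ℝ) ≠ 0 := by positivity
  have hdj : ((d + j).factorial : ℝ) ≠ 0 := by positivity
  field_simp
  rw [← h', mul_pow, mul_pow]
  ring

theorem poissonMeasure_ne_zero_le (r : ℝ≥0) :
    (poissonMeasure r) {n | n ≠ 0} ≤ r := by
  have h0 : (poissonMeasure r).real {0} = Real.exp (-r) := by
    rw [poissonMeasure_real_eq]; simp [poissonWeight]
  have hc : {n : ℕ | n ≠ 0} = ({0} : Set ℕ)ᶜ := by ext; simp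
  have h1 : (poissonMeasure r).real {n | n ≠ 0} ≤ r := by
    rw [hc, probReal_compl_eq_one_sub (MeasurableSet.singleton 0), h0]
    have := Real.add_one_le_exp (-(r : ℝ))
    linarith
  rw [← ENNReal.ofReal_coe_nnreal, ← ofReal_measureReal]
  exact ENNReal.ofReal_le_ofReal h1

theorem one_sub_pow_le_exp {p : ℝ} (hp : p ≤ 1) (j : ℕ) :
    (1 - p) ^ j ≤ Real.exp (-(j * p)) := by
  calc (1 - p) ^ j ≤ Real.exp (-p) ^ j :=
        pow_le_pow_left₀ (by linarith) (Real.one_sub_le_exp_neg p) _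
    _ = _ := by rw [← Real.exp_nat_mul]; ring_nf

/-- From log(1 - p) ≥ -p/(1 - p) ≥ -p(1 + 2p). Together with `one_sub_pow_le_exp` it pins (1 - p)^j
to exp(-jp), with an error 2jp² in the exponent. -/
theorem exp_le_one_sub_pow {p : ℝ} (h0 : 0 ≤ p) (hp : p < 1 / 2) (j : ℕ) :
    Real.exp (-(j * p) * (1 + 2 * p)) ≤ (1 - p) ^ j := by
  have hpos : 0 < 1 - p := by linarith
  have hlog : -p * (1 + 2 * p) ≤ Real.log (1 - p) := by
    refine le_trans ?_ (Real.one_sub_inv_le_log_of_pos hpos)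
    rw [show 1 - (1 - p)⁻¹ = -p / (1 - p) by field_simp; ring, le_div_iff₀ hpos]
    nlinarith [mul_nonneg (mul_nonneg h0 h0) (by linarith : 0 ≤ 1 - 2 * p)]
  rw [← Real.exp_log (pow_pos hpos j), Real.log_pow]
  refine Real.exp_le_exp.2 ?_
  have := mul_le_mul_of_nonneg_left hlog (Nat.cast_nonneg (α := ℝ) j)
  linarith

/-- The Poisson limit theorem with varying numbers of trials. -/
theorem tendsto_transProb_poissonWeight {j : ℕ → ℕ} {p : ℕ → ℝ} {r : ℝ}
    (hp0 : ∀ᶠ k in atTop, 0 ≤ p k) (hp : Tendsto p atTop (𝓝 0))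
    (hr : Tendsto (fun k => (j k : ℝ) * p k) atTop (𝓝 r)) (b : ℕ) :
    Tendsto (fun k => transProb (1 - p k) (j k) b) atTop (𝓝 (poissonWeight r b)) := by
  -- The binomial coefficient becomes a product of `b` factors, each tending to `r`. Truncated
  -- subtraction makes a factor vanish when `b` exceeds `j k`, so the formula needs no case
  -- distinction.
  have hform : ∀ k, transProb (1 - p k) (j k) b =
      (∏ t ∈ Finset.range b, (((j k - t : ℕ) : ℝ) * p k)) / b.factorial *
        (1 - p k) ^ (j k - b) := by
    intro k
    have hprod : ∏ t ∈ Finset.range b, (((j k - t : ℕ) : ℝ) * p k) =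
        ((j k).descFactorial b : ℝ) * p k ^ b := by
      rw [Finset.prod_mul_distrib, Nat.descFactorial_eq_prod_range]
      simp
    have hf : (b.factorial : ℝ) ≠ 0 := by positivity
    rw [hprod, Nat.descFactorial_eq_factorial_mul_choose]
    by_cases hb : b ≤ j k
    · rw [transProb, if_pos hb, sub_sub_cancel]
      push_cast
      field_simp
    · rw [transProb, if_neg hb, Nat.choose_eq_zero_of_lt (not_le.1 hb)]
      simp
  simp_rw [hform]
  have hfac : ∀ t ∈ Finset.range b,
      Tendsto (fun k => ((j k - t : ℕ) : ℝ) * p k) atTop (𝓝 r) := by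
    intro t _
    have hlow : Tendsto (fun k => (j k : ℝ) * p k - t * p k) atTop (𝓝 r) := by
      simpa using hr.sub (hp.const_mul (t : ℝ))
    refine tendsto_of_tendsto_of_tendsto_of_le_of_le' hlow hr ?_ ?_
    · filter_upwards [hp0] with k hk
      rw [← sub_mul]
      refine mul_le_mul_of_nonneg_right ?_ hk
      rw [sub_le_iff_le_add]
      exact_mod_cast (by omega : j k ≤ j k - t + t)
    · filter_upwards [hp0] with k hk
      exact mul_le_mul_of_nonneg_right (by exact_mod_cast Nat.sub_le _ _) hk
  have h1 := (tendsto_finsetProd (Finset.range b) hfac).div_const (b.factorial : ℝ)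
  rw [Finset.prod_const, Finset.card_range] at h1
  have hfull : Tendsto (fun k => (1 - p k) ^ (j k)) atTop (𝓝 (Real.exp (-r))) := by
    have hlt : ∀ᶠ k in atTop, p k < 1 / 2 := hp.eventually_lt_const (by norm_num)
    have hup : Tendsto (fun k => Real.exp (-((j k : ℝ) * p k))) atTop (𝓝 (Real.exp (-r))) :=
      (Real.continuous_exp.tendsto _).comp hr.neg
    have hdn : Tendsto (fun k => Real.exp (-((j k : ℝ) * p k) * (1 + 2 * p k))) atTop
        (𝓝 (Real.exp (-r))) := by
      have : Tendsto (fun k => -((j k : ℝ) * p k) * (1 + 2 * p k)) atTop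
          (𝓝 (-r * (1 + 2 * 0))) := hr.neg.mul ((hp.const_mul 2).const_add 1)
      simp only [mul_zero, add_zero, mul_one] at this
      exact (Real.continuous_exp.tendsto _).comp this
    refine tendsto_of_tendsto_of_tendsto_of_le_of_le' hdn hup ?_ ?_
    · filter_upwards [hp0, hlt] with k h0 hk using exp_le_one_sub_pow h0 hk _
    · filter_upwards [hp0, hlt] with k h0 hk using one_sub_pow_le_exp (by linarith) _
  have h2 : Tendsto (fun k => (1 - p k) ^ (j k - b)) atTop (𝓝 (Real.exp (-r))) := by
    have hlt : ∀ᶠ k in atTop, p k < 1 / 2 := hp.eventually_lt_const (by norm_num)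
    have hq : Tendsto (fun k => (1 - p k) ^ (j k) / (1 - p k) ^ b) atTop (𝓝 (Real.exp (-r))) := by
      have : Tendsto (fun k => (1 - p k) ^ b) atTop (𝓝 ((1 - 0) ^ b)) :=
        (hp.const_sub 1).pow b
      rw [sub_zero, one_pow] at this
      have hd := hfull.div this one_ne_zero
      rw [div_one] at hd
      exact hd
    refine tendsto_of_tendsto_of_tendsto_of_le_of_le' hfull hq ?_ ?_
    · filter_upwards [hp0, hlt] with k h0 hk
      exact pow_le_pow_of_le_one (by linarith) (by linarith) (Nat.sub_le _ _)
    · filter_upwards [hp0, hlt] with k h0 hk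
      rw [le_div_iff₀ (pow_pos (by linarith) b), ← pow_add]
      exact pow_le_pow_of_le_one (by linarith) (by linarith) (by omega)
  have := h1.mul h2
  convert! this using 2
  unfold poissonWeight
  ring

/-! ### The two-sided Poisson chain, built from independent departures. -/

/-- The sum of the entries of `ω` from time `m` on (a junk value if that sum is infinite). -/
noncomputable def tailSum (m : ℤ) (ω : ℤ → ℕ) : ℕ :=
  ⌊(∑' k : ℕ, (ω (m + k) : ℝ≥0∞)).toReal⌋₊

theorem tailSum_eq_sum {m : ℤ} {ω : ℤ → ℕ} {K : ℕ} (h : ∀ k : ℕ, K ≤ k → ω (m + k) = 0) :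
    tailSum m ω = ∑ k ∈ Finset.range K, ω (m + k) := by
  rw [tailSum, tsum_eq_sum (s := Finset.range K)]
  · rw [← Nat.cast_sum, ENNReal.toReal_natCast, Nat.floor_natCast]
  · intro k hk
    rw [h k (by simpa using hk), Nat.cast_zero]

theorem tailSum_eq_add {m : ℤ} {ω : ℤ → ℕ} (h : ∀ᶠ n : ℤ in atTop, ω n = 0) :
    tailSum m ω = ω m + tailSum (m + 1) ω := by
  obtain ⟨N, hN⟩ := eventually_atTop.1 h
  have h1 : ∀ k : ℕ, (N - m).toNat ≤ k → ω (m + 1 + k) = 0 := fun k hk => hN _ (by omega)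
  have h2 : ∀ k : ℕ, (N - m).toNat + 1 ≤ k → ω (m + k) = 0 := fun k hk => hN _ (by omega)
  rw [tailSum_eq_sum h1, tailSum_eq_sum h2, Finset.sum_range_succ', add_comm]
  congr 1
  · simp
  · refine Finset.sum_congr rfl fun k _ => ?_
    congr 1
    push_cast
    ring

/-- The σ-algebra is arbitrary so that the lemma also applies to the one generated by the
coordinates after a given time, as `departure_indep_tailSum` requires. -/
theorem measurable_tailSum_of {mΩ : MeasurableSpace (ℤ → ℕ)} {m : ℤ}
    (h : ∀ n, m ≤ n → Measurable fun ω : ℤ → ℕ => ω n) : Measurable (tailSum m) := by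
  refine Nat.measurable_floor.comp (ENNReal.measurable_toReal.comp ?_)
  refine Measurable.tsum fun k => ?_
  exact (measurable_of_countable (fun n : ℕ => (n : ℝ≥0∞))).comp (h _ (by omega))

theorem measurable_tailSum (m : ℤ) : Measurable (tailSum m) :=
  measurable_tailSum_of fun n _ => measurable_pi_apply n

variable {r L : ℤ → ℝ≥0}

theorem sum_range_eq_sub (hL : ∀ n, L n = r n + L (n + 1)) (m : ℤ) (K : ℕ) :
    (∑ k ∈ Finset.range K, r (m + k)) + L (m + K) = L m := by
  induction K with
  | zero => simp
  | succ K ih =>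
    rw [Finset.sum_range_succ, add_assoc, ← ih, hL (m + K)]
    push_cast
    simp only [add_assoc]

/-- Independent Poisson numbers of departures, with rate `r n` at time `n`. -/
noncomputable def departureLaw (r : ℤ → ℝ≥0) : Measure (ℤ → ℕ) :=
  Measure.infinitePi fun n => poissonMeasure (r n)

instance (r : ℤ → ℝ≥0) : IsProbabilityMeasure (departureLaw r) := by
  unfold departureLaw; infer_instance

theorem departureLaw_hasLaw (r : ℤ → ℝ≥0) (n : ℤ) :
    HasLaw (fun ω : ℤ → ℕ => ω n) (poissonMeasure (r n)) (departureLaw r) :=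
  ⟨(measurable_pi_apply n).aemeasurable, Measure.infinitePi_map_eval _ n⟩

theorem iIndepFun_departureLaw (r : ℤ → ℝ≥0) :
    iIndepFun (fun (n : ℤ) (ω : ℤ → ℕ) => ω n) (departureLaw r) :=
  iIndepFun_infinitePi (X := fun _ n => n) fun _ => measurable_id

/-- Borel–Cantelli: a departure occurs at time n with probability at most `r n`, and the partial
sums of these rates telescope to at most `L 0`. -/
theorem ae_eventually_eq_zero (hL : ∀ n, L n = r n + L (n + 1)) :
    ∀ᵐ ω ∂departureLaw r, ∀ᶠ n : ℤ in atTop, ω n = 0 := by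
  have hsum : Summable fun k : ℕ => r (0 + k) :=
    NNReal.summable_of_sum_range_le (c := L 0) fun K => by
      rw [← sum_range_eq_sub hL 0 K]; exact le_self_add
  have hle : ∀ k : ℕ, departureLaw r {ω | ω (0 + k) ≠ 0} ≤ r (0 + k) := by
    intro k
    have h := (departureLaw_hasLaw r (0 + k)).map_eq
    refine le_trans (le_of_eq ?_) (poissonMeasure_ne_zero_le (r (0 + k)))
    rw [← h, Measure.map_apply (measurable_pi_apply _) .of_discrete]
    rfl
  have hfin : ∑' k : ℕ, departureLaw r {ω | ω (0 + k) ≠ 0} ≠ ∞ :=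
    ne_top_of_le_ne_top (ENNReal.tsum_coe_ne_top_iff_summable.2 hsum) (ENNReal.tsum_le_tsum hle)
  filter_upwards [ae_eventually_notMem hfin] with ω hω
  obtain ⟨K, hK⟩ := eventually_atTop.1 hω
  refine eventually_atTop.2 ⟨K, fun n hn => ?_⟩
  have := hK n.toNat (by omega)
  rw [show (0 : ℤ) + n.toNat = n by omega] at this
  simpa using this

theorem hasLaw_sum_range (r : ℤ → ℝ≥0) (m : ℤ) (K : ℕ) :
    HasLaw (∑ k ∈ Finset.range K, fun ω : ℤ → ℕ => ω (m + k))
      (poissonMeasure (∑ k ∈ Finset.range K, r (m + k))) (departureLaw r) := by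
  induction K with
  | zero =>
    refine ⟨aemeasurable_const, ?_⟩
    simp only [Finset.range_zero, Finset.sum_empty]
    change (departureLaw r).map (fun _ => 0) = _
    rw [Measure.map_const, measure_univ, one_smul]
    refine Measure.ext_of_singleton fun n => ?_
    rw [poissonMeasure_singleton]
    rcases n with _ | n <;> simp
  | succ K ih =>
    rw [Finset.sum_range_succ, Finset.sum_range_succ]
    refine IndepFun.hasLaw_add_poissonMeasure ?_ ih (departureLaw_hasLaw r (m + K))
    have hi : iIndepFun (fun (k : ℕ) (ω : ℤ → ℕ) => ω (m + k)) (departureLaw r) :=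
      (iIndepFun_departureLaw r).precomp (g := fun k : ℕ => m + k) fun a b h => by
        simpa using h
    exact hi.indepFun_finsetSum_of_notMem (fun k => measurable_pi_apply _) (by simp)

/-- The finite sums are Poisson with mean L m - L (m + K), and almost surely they equal `tailSum`
for large K; both descriptions of the limiting probability must agree. -/
theorem tailSum_marginal (hL : ∀ n, L n = r n + L (n + 1)) (hL0 : Tendsto L atTop (𝓝 0))
    (m : ℤ) (b : ℕ) :
    (departureLaw r).real {ω | tailSum m ω = b} = poissonWeight (L m) b := by
  have hS : ∀ K : ℕ, (departureLaw r).real {ω | ∑ k ∈ Finset.range K, ω (m + k) = b} =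
      poissonWeight (L m - L (m + K)) b := by
    intro K
    have h := (hasLaw_sum_range r m K).map_eq
    have hr : ((∑ k ∈ Finset.range K, r (m + k) : ℝ≥0) : ℝ) = L m - L (m + K) := by
      rw [← sum_range_eq_sub hL m K]; push_cast; ring
    rw [← hr, ← poissonMeasure_real_eq, ← h, map_measureReal_apply (by fun_prop) (by simp)]
    congr 1
    ext ω
    simp
  have h1 : Tendsto (fun K : ℕ =>
      (departureLaw r).real {ω | ∑ k ∈ Finset.range K, ω (m + k) = b}) atTop
      (𝓝 (poissonWeight (L m) b)) := by
    simp_rw [hS]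
    have hc : Continuous fun x : ℝ => poissonWeight x b := by unfold poissonWeight; fun_prop
    have hm : Tendsto (fun K : ℕ => m + (K : ℤ)) atTop atTop :=
      tendsto_atTop_add_const_left _ _ tendsto_natCast_atTop_atTop
    have hz : Tendsto (fun K : ℕ => (L (m + K) : ℝ)) atTop (𝓝 0) := by
      simpa [Function.comp_def] using NNReal.tendsto_coe.2 (hL0.comp hm)
    have := (hc.tendsto _).comp (hz.const_sub (L m : ℝ))
    simpa [Function.comp_def] using this
  have h2 : Tendsto (fun K : ℕ =>
      (departureLaw r) {ω | ∑ k ∈ Finset.range K, ω (m + k) = b}) atTop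
      (𝓝 ((departureLaw r) {ω | tailSum m ω = b})) := by
    refine tendsto_measure_of_ae_tendsto_indicator_of_isFiniteMeasure atTop
      (measurable_tailSum m (MeasurableSet.singleton b)) (fun K => ?_) ?_
    · have : Measurable fun ω : ℤ → ℕ => ∑ k ∈ Finset.range K, ω (m + k) := by fun_prop
      exact this (MeasurableSet.singleton b)
    · filter_upwards [ae_eventually_eq_zero hL] with ω hω
      obtain ⟨N, hN⟩ := eventually_atTop.1 hω
      filter_upwards [eventually_ge_atTop (N - m).toNat] with K hK
      have := tailSum_eq_sum (m := m) (ω := ω) (K := K) fun k hk => hN _ (by omega)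
      change _ = b ↔ tailSum m ω = b
      rw [this]
  exact tendsto_nhds_unique
    ((ENNReal.tendsto_toReal (measure_ne_top _ _)).comp h2) h1

/-- The two events depend on disjoint sets of independent coordinates: l alone, and the times after
l. -/
theorem departure_indep_tailSum (r : ℤ → ℝ≥0) (l n : ℤ) (d : ℕ) (i : ℤ → ℕ) :
    (departureLaw r).real ({ω | ω l = d} ∩ {ω | ∀ s ∈ Set.Icc (l + 1) n, tailSum s ω = i s}) =
      poissonWeight (r l) d *
        (departureLaw r).real {ω | ∀ s ∈ Set.Icc (l + 1) n, tailSum s ω = i s} := by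
  have hind := indep_iSup_of_disjoint
    (m := fun n : ℤ => MeasurableSpace.comap (fun ω : ℤ → ℕ => ω n) inferInstance)
    (fun n => (measurable_pi_apply (X := fun _ : ℤ => ℕ) n).comap_le)
    (iIndepFun_departureLaw r).iIndep (S := {l}) (T := Set.Ioi l) (by simp)
  have h1 : MeasurableSet[⨆ n ∈ ({l} : Set ℤ),
      MeasurableSpace.comap (fun ω : ℤ → ℕ => ω n) inferInstance] {ω | ω l = d} := by
    have : MeasurableSpace.comap (fun ω : ℤ → ℕ => ω l) inferInstance ≤ ⨆ n ∈ ({l} : Set ℤ),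
      MeasurableSpace.comap (fun ω : ℤ → ℕ => ω n) inferInstance :=
      le_iSup₂_of_le l rfl le_rfl
    exact this _ ⟨{d}, MeasurableSet.singleton d, rfl⟩
  have h2 : MeasurableSet[⨆ n ∈ Set.Ioi l,
      MeasurableSpace.comap (fun ω : ℤ → ℕ => ω n) inferInstance]
      {ω | ∀ s ∈ Set.Icc (l + 1) n, tailSum s ω = i s} := by
    have : {ω | ∀ s ∈ Set.Icc (l + 1) n, tailSum s ω = i s} =
        ⋂ s ∈ Set.Icc (l + 1) n, {ω | tailSum s ω = i s} := by
      ext x; simp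
    rw [this]
    refine MeasurableSet.biInter (Set.to_countable _) fun s hs => ?_
    refine measurable_tailSum_of ?_ (MeasurableSet.singleton (i s))
    intro t ht
    rw [measurable_iff_comap_le]
    exact le_iSup₂_of_le t (Set.mem_Ioi.2 (by have := hs.1; omega)) le_rfl
  have h := (Indep_iff _ _ _).1 hind _ _ h1 h2
  have hd : (departureLaw r).real {ω | ω l = d} = poissonWeight (r l) d := by
    rw [← poissonMeasure_real_eq, ← (departureLaw_hasLaw r l).map_eq,
      map_measureReal_apply (measurable_pi_apply l) (by simp)]
    rfl
  rw [← hd, measureReal_def, h, ENNReal.toReal_mul, measureReal_def, measureReal_def]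

/-- Since X_l is the departure at l plus X_(l+1), a prescribed path fixes that departure, which is
independent of everything later. -/
theorem tailSum_cylinder (hL : ∀ n, L n = r n + L (n + 1)) {l n : ℤ} (hln : l + 1 ≤ n)
    (i : ℤ → ℕ) :
    (departureLaw r).real {ω | ∀ s ∈ Set.Icc l n, tailSum s ω = i s} =
      (if i (l + 1) ≤ i l then poissonWeight (r l) (i l - i (l + 1)) else 0) *
        (departureLaw r).real {ω | ∀ s ∈ Set.Icc (l + 1) n, tailSum s ω = i s} := by
  have hrec : ∀ ω : ℤ → ℕ, (∀ᶠ n : ℤ in atTop, ω n = 0) →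
      ((∀ s ∈ Set.Icc l n, tailSum s ω = i s) ↔
        ω l + i (l + 1) = i l ∧ ∀ s ∈ Set.Icc (l + 1) n, tailSum s ω = i s) := by
    intro ω hω
    have hadd := tailSum_eq_add (m := l) hω
    simp only [Set.mem_Icc]
    constructor
    · intro h
      have ha := h l ⟨le_rfl, by omega⟩
      have hb := h (l + 1) ⟨by omega, hln⟩
      exact ⟨by omega, fun s hs => h s ⟨by omega, hs.2⟩⟩
    · rintro ⟨h1, h2⟩ s ⟨hs1, hs2⟩
      rcases eq_or_lt_of_le hs1 with rfl | hs
      · have := h2 (l + 1) ⟨le_rfl, hln⟩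
        omega
      · exact h2 s ⟨by omega, hs2⟩
  split_ifs with hi
  · rw [← departure_indep_tailSum]
    refine measureReal_congr ?_
    filter_upwards [ae_eventually_eq_zero hL] with ω hω
    apply propext
    refine (hrec ω hω).trans ?_
    change _ ↔ ω l = _ ∧ _
    refine and_congr ?_ Iff.rfl
    omega
  · rw [zero_mul, measureReal_eq_zero_iff]
    refine measure_mono_null (t := {ω | ¬ ∀ᶠ n : ℤ in atTop, ω n = 0}) (fun ω hω hc => ?_)
      (ae_eventually_eq_zero hL)
    have := ((hrec ω hc).1 hω).1
    omega

/-- Peeling off the earliest time multiplies both sides by the same factor, so only the cylinder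
with the two times n and n + 1 remains; there the claim is Poisson splitting. -/
theorem tailSum_markov {θ : ℝ} (hL : ∀ n, L n = r n + L (n + 1)) (hL0 : Tendsto L atTop (𝓝 0))
    (hrθ : ∀ n, (r n : ℝ) = L n * θ) (hLθ : ∀ n, (L (n + 1) : ℝ) = L n * (1 - θ))
    {l n : ℤ} (hln : l ≤ n) (i : ℤ → ℕ) :
    (departureLaw r).real {ω | ∀ s ∈ Set.Icc l (n + 1), tailSum s ω = i s} =
      (departureLaw r).real {ω | ∀ s ∈ Set.Icc l n, tailSum s ω = i s} *
        transProb θ (i n) (i (n + 1)) := by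
  obtain ⟨d, rfl⟩ := Int.exists_add_of_le hln
  clear hln
  induction d generalizing l with
  | zero =>
    have hone : ∀ m : ℤ, {ω | ∀ s ∈ Set.Icc m m, tailSum s ω = i s} = {ω | tailSum m ω = i m} := by
      intro m; ext ω; simp
    simp only [Nat.cast_zero, add_zero]
    rw [tailSum_cylinder hL le_rfl, hone, hone, tailSum_marginal hL hL0, tailSum_marginal hL hL0]
    split_ifs with hi
    · have h := poissonWeight_mul_poissonWeight (L l) θ (i l - i (l + 1)) (i (l + 1))
      rw [Nat.sub_add_cancel hi] at h
      rw [hrθ, hLθ, h]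
    · simp [transProb, hi]
  | succ d ih =>
    have := ih (l := l + 1)
    rw [show l + ((d + 1 : ℕ) : ℤ) = l + 1 + d by push_cast; ring,
      tailSum_cylinder hL (l := l) (by omega), tailSum_cylinder hL (l := l) (by omega), this,
      mul_assoc]

/-- The two-sided chain with Poisson marginals. -/
theorem exists_poisson_chain {θ : ℝ} (hL : ∀ n, L n = r n + L (n + 1))
    (hL0 : Tendsto L atTop (𝓝 0))
    (hrθ : ∀ n, (r n : ℝ) = L n * θ) (hLθ : ∀ n, (L (n + 1) : ℝ) = L n * (1 - θ)) :
    ∃ P : ProbabilityMeasure (ℤ → ℕ), IsTwoSidedChain θ P ∧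
      ∀ n b, (P : Measure (ℤ → ℕ)).real {x | x n = b} = poissonWeight (L n) b := by
  have hmeas : Measurable fun (ω : ℤ → ℕ) (n : ℤ) => tailSum n ω :=
    measurable_pi_lambda _ measurable_tailSum
  refine ⟨⟨(departureLaw r).map fun ω n => tailSum n ω,
    Measure.isProbabilityMeasure_map hmeas.aemeasurable⟩, ?_, ?_⟩
  · intro l n hln i
    change ((departureLaw r).map fun ω n => tailSum n ω).real _ =
      ((departureLaw r).map fun ω n => tailSum n ω).real _ * _
    rw [map_measureReal_apply hmeas (measurableSet_cylinder l (n + 1) i),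
      map_measureReal_apply hmeas (measurableSet_cylinder l n i)]
    exact tailSum_markov hL hL0 hrθ hLθ hln i
  · intro n b
    change ((departureLaw r).map fun ω n => tailSum n ω).real _ = _
    rw [map_measureReal_apply hmeas (measurableSet_coord n b)]
    exact tailSum_marginal hL hL0 n b

/-! ### Weak convergence to the Poisson chain. -/

/-- The cylinder of paths that agree with `i` on `[-N, N]`. -/
def symmCylinder (N : ℕ) (i : ℤ → ℕ) : Set (ℤ → ℕ) :=
  {x | ∀ s ∈ Set.Icc (-(N : ℤ)) N, x s = i s}

theorem isPiSystem_symmCylinder :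
    IsPiSystem {A | ∃ (N : ℕ) (i : ℤ → ℕ), A = symmCylinder N i} := by
  rintro _ ⟨N, i, rfl⟩ _ ⟨M, i', rfl⟩ ⟨x, hx, hx'⟩
  -- Any path in the intersection can serve as the label of the intersection cylinder.
  refine ⟨max N M, x, ?_⟩
  ext y
  simp only [symmCylinder, Set.mem_inter_iff, Set.mem_ofPred_eq, Set.mem_Icc] at hx hx' ⊢
  constructor
  · rintro ⟨h1, h2⟩ s hs
    rcases le_total N M with h | h
    · rw [h2 s (by omega), hx' s (by omega)]
    · rw [h1 s (by omega), hx s (by omega)]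
  · intro h
    exact ⟨fun s hs => by rw [h s (by omega), hx s hs],
      fun s hs => by rw [h s (by omega), hx' s hs]⟩

theorem symmCylinder_mem_nhds (N : ℕ) (x : ℤ → ℕ) : symmCylinder N x ∈ 𝓝 x := by
  have : symmCylinder N x = (Set.Icc (-(N : ℤ)) N).pi fun s => {x s} := by
    ext y; simp [symmCylinder]
  rw [this]
  exact set_pi_mem_nhds (Set.finite_Icc _ _) fun s _ => by simp

theorem exists_symmCylinder_subset {u : Set (ℤ → ℕ)} (hu : IsOpen u) {x : ℤ → ℕ} (hx : x ∈ u) :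
    ∃ N : ℕ, symmCylinder N x ⊆ u := by
  obtain ⟨I, v, hv, hvu⟩ := isOpen_pi_iff.1 hu x hx
  refine ⟨I.sup Int.natAbs, fun y hy => hvu fun s hs => ?_⟩
  have hle : s.natAbs ≤ I.sup Int.natAbs := Finset.le_sup (f := Int.natAbs) hs
  rw [hy s (Set.mem_Icc.2 (by omega))]
  exact (hv s hs).2

/-- The intensity at time `n` of the Poisson chain with parameter `lam`. -/
noncomputable def intensity (θ lam : ℝ) (n : ℤ) : ℝ := lam * (1 - θ) ^ (n - 1)

theorem tendsto_startLaw {θ : ℝ} (hθ : θ ∈ Set.Ioo (0 : ℝ) 1) {lam : ℝ}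
    {P : ProbabilityMeasure (ℤ → ℕ)} (hP : IsTwoSidedChain θ P)
    (hm : ∀ n b, (P : Measure (ℤ → ℕ)).real {x | x n = b} = poissonWeight (intensity θ lam n) b)
    {j : ℕ → ℕ} (hj : Tendsto (fun k => (j k : ℝ) * (1 - θ) ^ k) atTop (𝓝 lam)) :
    Tendsto (fun k => startLaw θ hθ k (j k)) atTop (𝓝 P) := by
  have hq0 : 0 < 1 - θ := by linarith [hθ.2]
  have hq1 : 1 - θ < 1 := by linarith [hθ.1]
  have hmarg : ∀ (l : ℤ) (b : ℕ),
      Tendsto (fun k => (startLaw θ hθ k (j k) : Measure (ℤ → ℕ)).real {x | x l = b}) atTop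
        (𝓝 ((P : Measure (ℤ → ℕ)).real {x | x l = b})) := by
    intro l b
    simp_rw [startLaw_marginal, hm]
    refine tendsto_transProb_poissonWeight (p := fun k => (1 - θ) ^ (l + k - 1).toNat)
      (Eventually.of_forall fun k => by positivity) ?_ ?_ b
    · refine (tendsto_pow_atTop_nhds_zero_of_lt_one hq0.le hq1).comp ?_
      refine tendsto_atTop.2 fun N => ?_
      filter_upwards [eventually_ge_atTop (N + 1 + l.natAbs)] with k hk
      omega
    · refine (hj.mul_const ((1 - θ) ^ (l - 1))).congr' ?_
      filter_upwards [eventually_ge_atTop (1 + l.natAbs)] with k hk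
      rw [mul_assoc, ← zpow_natCast, ← zpow_natCast, ← zpow_add₀ hq0.ne']
      congr 2
      omega
  have hcyl : ∀ (l : ℤ) (d : ℕ) (i : ℤ → ℕ),
      Tendsto (fun k => (startLaw θ hθ k (j k) : Measure (ℤ → ℕ)).real
        {x | ∀ s ∈ Set.Icc l (l + d), x s = i s}) atTop
        (𝓝 ((P : Measure (ℤ → ℕ)).real {x | ∀ s ∈ Set.Icc l (l + d), x s = i s})) := by
    intro l d i
    induction d with
    | zero =>
      have : {x : ℤ → ℕ | ∀ s ∈ Set.Icc l (l + (0 : ℕ)), x s = i s} = {x | x l = i l} := by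
        ext x; simp
      rw [this]
      exact hmarg l (i l)
    | succ d ih =>
      have hle : l ≤ l + (d : ℤ) := by omega
      have hcast : l + ((d + 1 : ℕ) : ℤ) = l + d + 1 := by push_cast; ring
      rw [hcast, hP l (l + d) hle i]
      refine (ih.mul_const _).congr' ?_
      -- For such k the window starts no earlier than time -k + 1, so the Markov property holds
      -- throughout it.
      filter_upwards [eventually_ge_atTop (1 + l.natAbs)] with k hk
      exact (startLaw_markov hθ k (j k) hle (by omega) i).symm
  refine isPiSystem_symmCylinder.tendsto_probabilityMeasure_of_tendsto_of_mem ?_ ?_ ?_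
  · rintro _ ⟨N, i, rfl⟩
    exact measurableSet_cylinder _ _ i
  · intro u hu x hx
    obtain ⟨N, hN⟩ := exists_symmCylinder_subset hu hx
    exact ⟨_, ⟨N, x, rfl⟩, symmCylinder_mem_nhds N x, hN⟩
  · rintro _ ⟨N, i, rfl⟩
    have h := hcyl (-N) (2 * N) i
    have e : -(N : ℤ) + ((2 * N : ℕ) : ℤ) = N := by push_cast; ring
    rw [e] at h
    exact tendsto_subtype_rng.2 h

/-! ### Necessity: weak convergence makes j_k (1 - θ)^k converge. -/

/-- The event is clopen, so its probability converges. At time 1 the survival exponent is exactly k.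
-/
theorem tendsto_startLaw_real {θ : ℝ} (hθ : θ ∈ Set.Ioo (0 : ℝ) 1)
    {Q : ProbabilityMeasure (ℤ → ℕ)} {j : ℕ → ℕ}
    (hQ : Tendsto (fun k => startLaw θ hθ k (j k)) atTop (𝓝 Q)) (b : ℕ) :
    Tendsto (fun k => transProb (1 - (1 - θ) ^ k) (j k) b) atTop
      (𝓝 ((Q : Measure (ℤ → ℕ)).real {x | x 1 = b})) := by
  have hcl : IsClopen {x : ℤ → ℕ | x 1 = b} :=
    (isClopen_discrete ({b} : Set ℕ)).preimage (continuous_apply (A := fun _ : ℤ => ℕ) 1)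
  have h := ProbabilityMeasure.tendsto_measure_of_isClopen_of_tendsto hQ hcl
  have h' : Tendsto (fun k => (startLaw θ hθ k (j k) : Measure (ℤ → ℕ)).real {x | x 1 = b}) atTop
      (𝓝 ((Q : Measure (ℤ → ℕ)).real {x | x 1 = b})) :=
    (NNReal.tendsto_coe).2 h
  refine h'.congr fun k => ?_
  rw [startLaw_marginal]
  congr 3
  omega

/-- The bound depends on j and p only through t = jp, up to a constant, and tends to 0 as t → ∞: a
large mean leaves little mass at a fixed b. The factor exp(b) pays for the exponent j - b in place
of j. -/
theorem transProb_le_exp {p : ℝ} (h0 : 0 ≤ p) (h1 : p ≤ 1) (j b : ℕ) :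
    transProb (1 - p) j b ≤
      ((j * p) ^ b * Real.exp (-(j * p))) * (Real.exp b / b.factorial) := by
  unfold transProb
  split_ifs with hb
  · rw [sub_sub_cancel]
    have hA : (j.choose b : ℝ) ≤ (j : ℝ) ^ b / b.factorial := Nat.choose_le_pow_div b j
    have hB : (1 - p) ^ (j - b) ≤ Real.exp (-(j * p)) * Real.exp b := by
      refine (one_sub_pow_le_exp h1 (j - b)).trans ?_
      rw [← Real.exp_add, Nat.cast_sub hb]
      refine Real.exp_le_exp.2 ?_
      nlinarith [mul_le_mul_of_nonneg_left h1 (Nat.cast_nonneg (α := ℝ) b)]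
    have h1' : 0 ≤ 1 - p := by linarith
    calc (j.choose b : ℝ) * (1 - p) ^ (j - b) * p ^ b
        ≤ ((j : ℝ) ^ b / b.factorial) * (Real.exp (-(j * p)) * Real.exp b) * p ^ b := by
          gcongr
      _ = _ := by rw [mul_pow]; ring
  · positivity

theorem exists_tendsto_of_tendsto_startLaw {θ : ℝ} (hθ : θ ∈ Set.Ioo (0 : ℝ) 1)
    {Q : ProbabilityMeasure (ℤ → ℕ)} {j : ℕ → ℕ}
    (hQ : Tendsto (fun k => startLaw θ hθ k (j k)) atTop (𝓝 Q)) :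
    ∃ lam : ℝ, 0 ≤ lam ∧ Tendsto (fun k => (j k : ℝ) * (1 - θ) ^ k) atTop (𝓝 lam) := by
  have hq0 : 0 < 1 - θ := by linarith [hθ.2]
  have hq1 : 1 - θ < 1 := by linarith [hθ.1]
  -- A state charged by the limit keeps its probability bounded away from 0 along the sequence,
  -- which by `transProb_le_exp` keeps the means bounded.
  obtain ⟨b, hb⟩ : ∃ b : ℕ, 0 < (Q : Measure (ℤ → ℕ)).real {x | x 1 = b} := by
    by_contra! hcon
    have hU : (Set.univ : Set (ℤ → ℕ)) = ⋃ b : ℕ, {x | x 1 = b} := by ext; simp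
    have hz : (Q : Measure (ℤ → ℕ)) Set.univ = 0 := by
      rw [hU]
      exact measure_iUnion_null fun b =>
        (measureReal_eq_zero_iff).1 (le_antisymm (hcon b) measureReal_nonneg)
    simp at hz
  have hbd : ∃ B : ℝ, ∀ᶠ k in atTop, (j k : ℝ) * (1 - θ) ^ k ≤ B := by
    set a := (Q : Measure (ℤ → ℕ)).real {x | x 1 = b} with ha
    have h1 : ∀ᶠ k in atTop, a / 2 < transProb (1 - (1 - θ) ^ k) (j k) b :=
      (tendsto_startLaw_real hθ hQ b).eventually_const_lt (by linarith)
    have h2 : Tendsto (fun t : ℝ => (t ^ b * Real.exp (-t)) * (Real.exp b / b.factorial)) atTop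
        (𝓝 0) := by
      simpa using (Real.tendsto_pow_mul_exp_neg_atTop_nhds_zero b).mul_const
        (Real.exp b / b.factorial)
    obtain ⟨B, hB⟩ := eventually_atTop.1
      (h2.eventually_lt_const (show (0 : ℝ) < a / 2 by linarith))
    refine ⟨B, ?_⟩
    filter_upwards [h1] with k hk
    by_contra! hlt
    have := transProb_le_exp (pow_nonneg hq0.le k) (pow_le_one₀ hq0.le hq1.le) (j k) b
    linarith [hB _ hlt.le]
  obtain ⟨B, hB⟩ := hbd
  have hp : Tendsto (fun k => (1 - θ) ^ k) atTop (𝓝 0) :=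
    tendsto_pow_atTop_nhds_zero_of_lt_one hq0.le hq1
  set a₀ := (Q : Measure (ℤ → ℕ)).real {x | x 1 = 0} with ha₀
  have h0 : Tendsto (fun k => (1 - (1 - θ) ^ k) ^ j k) atTop (𝓝 a₀) := by
    refine (tendsto_startLaw_real hθ hQ 0).congr fun k => ?_
    simp [transProb]
  have hexp : Tendsto (fun k => Real.exp (-((j k : ℝ) * (1 - θ) ^ k))) atTop (𝓝 a₀) := by
    -- With m = jp ≤ B, exp(-m) - (1 - p)^j is at most exp(-m)(1 - exp(-2mp)) ≤ 2mp ≤ 2Bp, which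
    -- vanishes with p.
    have hup : Tendsto (fun k => (1 - (1 - θ) ^ k) ^ j k + 2 * B * (1 - θ) ^ k) atTop (𝓝 a₀) := by
      simpa using h0.add (hp.const_mul (2 * B))
    refine tendsto_of_tendsto_of_tendsto_of_le_of_le' h0 hup ?_ ?_
    · exact Eventually.of_forall fun k => one_sub_pow_le_exp (pow_le_one₀ hq0.le hq1.le) _
    · filter_upwards [hB, hp.eventually_lt_const (show (0 : ℝ) < 1 / 2 by norm_num)] with k hk hk2
      have hpk : 0 ≤ (1 - θ) ^ k := by positivity
      have hmu : 0 ≤ (j k : ℝ) * (1 - θ) ^ k := by positivity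
      have hlow := exp_le_one_sub_pow hpk hk2 (j k)
      set m := (j k : ℝ) * (1 - θ) ^ k
      set p := (1 - θ) ^ k
      have e1 : Real.exp (-m * (1 + 2 * p)) = Real.exp (-m) * Real.exp (-(2 * m * p)) := by
        rw [← Real.exp_add]; ring_nf
      have e2 := Real.one_sub_le_exp_neg (2 * m * p)
      have e3 : Real.exp (-m) ≤ 1 := Real.exp_le_one_iff.2 (by linarith)
      have e4 : 0 < Real.exp (-m) := Real.exp_pos _
      have e5 : m * p ≤ B * p := mul_le_mul_of_nonneg_right hk hpk
      have e6 : Real.exp (-m) * (1 - 2 * m * p) ≤ Real.exp (-m) * Real.exp (-(2 * m * p)) :=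
        mul_le_mul_of_nonneg_left e2 e4.le
      have e7 : Real.exp (-m) * (2 * m * p) ≤ 1 * (2 * m * p) :=
        mul_le_mul_of_nonneg_right e3 (by positivity)
      nlinarith
  -- Boundedness of the means is what keeps the limit away from 0, so that the logarithm can be
  -- taken.
  have ha₀pos : 0 < a₀ := by
    refine lt_of_lt_of_le (Real.exp_pos (-B)) (ge_of_tendsto hexp ?_)
    filter_upwards [hB] with k hk
    exact Real.exp_le_exp.2 (by linarith)
  have hlog : Tendsto (fun k => (j k : ℝ) * (1 - θ) ^ k) atTop (𝓝 (-Real.log a₀)) := by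
    simpa [Function.comp_def] using
      ((Real.continuousAt_log ha₀pos.ne').tendsto.comp hexp).neg
  exact ⟨_, ge_of_tendsto hlog (Eventually.of_forall fun k => by positivity), hlog⟩

/-! ### The law of large numbers at -∞. -/

theorem lintegral_sq_of_poisson {P : Measure (ℤ → ℕ)} [IsProbabilityMeasure P] {n : ℤ} {r : ℝ}
    (hr : 0 < r) (hm : ∀ b, P.real {x | x n = b} = poissonWeight r b) :
    ∫⁻ x, ENNReal.ofReal (((x n : ℝ) / r - 1) ^ 2) ∂P = ENNReal.ofReal (1 / r) := by
  have hmeas : Measurable fun x : ℤ → ℕ => x n := measurable_pi_apply n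
  have h1 : ∫⁻ x, ENNReal.ofReal (((x n : ℝ) / r - 1) ^ 2) ∂P =
      ∫⁻ a : ℕ, ENNReal.ofReal (((a : ℝ) / r - 1) ^ 2) ∂(P.map fun x => x n) := by
    rw [lintegral_map (measurable_of_countable _) hmeas]
  have hsum := (hasSum_variance_poissonWeight hr.le).mul_left (1 / r ^ 2)
  rw [show 1 / r ^ 2 * r = 1 / r by field_simp] at hsum
  rw [h1, lintegral_countable', ← hsum.tsum_eq, ENNReal.ofReal_tsum_of_nonneg _ hsum.summable]
  · refine tsum_congr fun a => ?_
    have hmass : (P.map fun x => x n) {a} = ENNReal.ofReal (poissonWeight r a) := by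
      rw [Measure.map_apply hmeas (MeasurableSet.singleton a), ← hm a, ofReal_measureReal]
      rfl
    rw [hmass, ← ENNReal.ofReal_mul (sq_nonneg _)]
    congr 1
    field_simp
  · intro a
    have := poissonWeight_nonneg hr.le a
    positivity

/-- The law of large numbers at `-∞` for a process with Poisson marginals. -/
theorem ae_tendsto_div_intensity {θ : ℝ} (hθ : θ ∈ Set.Ioo (0 : ℝ) 1) {lam : ℝ} (hlam : 0 < lam)
    {P : Measure (ℤ → ℕ)} [IsProbabilityMeasure P]
    (hm : ∀ n b, P.real {x | x n = b} = poissonWeight (intensity θ lam n) b) :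
    ∀ᵐ x ∂P, Tendsto (fun n : ℤ => (x n : ℝ) / intensity θ lam n) atBot (𝓝 1) := by
  have hq0 : 0 < 1 - θ := by linarith [hθ.2]
  have hq1 : 1 - θ < 1 := by linarith [hθ.1]
  have hpos : ∀ n, 0 < intensity θ lam n := fun n => mul_pos hlam (zpow_pos hq0 _)
  have hinv : ∀ k : ℕ, 1 / intensity θ lam (-k) = (1 - θ) / lam * (1 - θ) ^ k := by
    intro k
    rw [intensity, show -(k : ℤ) - 1 = -((k + 1 : ℕ) : ℤ) by push_cast; ring, zpow_neg,
      zpow_natCast, pow_succ]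
    field_simp
  -- The variances form a geometric series, so the sum of squared deviations has finite mean. It is
  -- then almost surely finite and its terms tend to 0.
  have hfin : ∫⁻ x, ∑' k : ℕ,
      ENNReal.ofReal (((x (-k) : ℝ) / intensity θ lam (-k) - 1) ^ 2) ∂P ≠ ∞ := by
    rw [lintegral_tsum]
    · simp_rw [lintegral_sq_of_poisson (hpos _) (hm _), hinv]
      rw [← ENNReal.ofReal_tsum_of_nonneg]
      · exact ENNReal.ofReal_ne_top
      · intro k; positivity
      · exact (summable_geometric_of_lt_one hq0.le hq1).mul_left _
    · intro k
      refine Measurable.aemeasurable ?_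
      exact (measurable_of_countable fun a : ℕ =>
        ENNReal.ofReal (((a : ℝ) / intensity θ lam (-k) - 1) ^ 2)).comp (measurable_pi_apply _)
  have hmeas : Measurable fun x : ℤ → ℕ => ∑' k : ℕ,
      ENNReal.ofReal (((x (-k) : ℝ) / intensity θ lam (-k) - 1) ^ 2) :=
    Measurable.tsum fun k => (measurable_of_countable fun a : ℕ =>
        ENNReal.ofReal (((a : ℝ) / intensity θ lam (-k) - 1) ^ 2)).comp (measurable_pi_apply _)
  filter_upwards [ae_lt_top hmeas hfin] with x hx
  have h0 := ENNReal.tendsto_atTop_zero_of_tsum_ne_top hx.ne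
  have h1 : Tendsto (fun k : ℕ => ((x (-k) : ℝ) / intensity θ lam (-k) - 1) ^ 2) atTop (𝓝 0) := by
    have := (ENNReal.tendsto_toReal ENNReal.zero_ne_top).comp h0
    simpa [Function.comp_def, ENNReal.toReal_ofReal (sq_nonneg _)] using this
  have h2 : Tendsto (fun k : ℕ => (x (-k) : ℝ) / intensity θ lam (-k)) atTop (𝓝 1) := by
    have h3 := (Real.continuous_sqrt.tendsto 0).comp h1
    simp only [Function.comp_def, Real.sqrt_sq_eq_abs, Real.sqrt_zero] at h3
    have h4 := (tendsto_zero_iff_abs_tendsto_zero _).2 h3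
    simpa using h4.add_const 1
  have h5 : Tendsto (fun n : ℤ => (-n).toNat) atBot atTop := by
    refine tendsto_atTop.2 fun N => ?_
    filter_upwards [eventually_le_atBot (-(N : ℤ))] with n hn
    omega
  refine (h2.comp h5).congr' ?_
  filter_upwards [eventually_le_atBot (0 : ℤ)] with n hn
  have : -(((-n).toNat : ℕ) : ℤ) = n := by omega
  simp only [Function.comp_def, this]

/-! ### Passage to the logarithmic scale. -/

theorem log_one_sub_neg {θ : ℝ} (hθ : θ ∈ Set.Ioo (0 : ℝ) 1) : Real.log (1 - θ) < 0 :=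
  Real.log_neg (by linarith [hθ.2]) (by linarith [hθ.1])

theorem c_pos {θ : ℝ} (hθ : θ ∈ Set.Ioo (0 : ℝ) 1) : 0 < c θ := by
  have := log_one_sub_neg hθ
  rw [c, neg_pos]
  exact one_div_neg.2 this

theorem c_mul_log {θ : ℝ} (hθ : θ ∈ Set.Ioo (0 : ℝ) 1) : c θ * Real.log (1 - θ) = -1 := by
  have := (log_one_sub_neg hθ).ne
  rw [c]
  field_simp

/-- The summand 1 in the limit comes from the exponent n - 1 in `intensity`: c(θ) times the log of
the mean is z - (n - 1). -/
theorem ae_tendsto_log {θ : ℝ} (hθ : θ ∈ Set.Ioo (0 : ℝ) 1) (z : ℝ)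
    {P : Measure (ℤ → ℕ)} [IsProbabilityMeasure P]
    (hm : ∀ n b, P.real {x | x n = b} =
      poissonWeight (intensity θ (Real.exp (z / c θ)) n) b) :
    ∀ᵐ x ∂P, (∀ᶠ n : ℤ in atBot, 0 < x n) ∧
      Tendsto (fun n : ℤ => c θ * Real.log (x n) + n) atBot (𝓝 (z + 1)) := by
  have hq0 : 0 < 1 - θ := by linarith [hθ.2]
  filter_upwards [ae_tendsto_div_intensity hθ (Real.exp_pos _) hm] with x hx
  have hpos : ∀ᶠ n : ℤ in atBot, 0 < x n := by
    filter_upwards [hx.eventually_const_lt zero_lt_one] with n hn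
    rcases Nat.eq_zero_or_pos (x n) with h | h
    · simp [h] at hn
    · exact h
  refine ⟨hpos, ?_⟩
  have hlog := ((Real.continuousAt_log one_ne_zero).tendsto.comp hx).const_mul (c θ)
  rw [Real.log_one, mul_zero] at hlog
  have := hlog.add_const (z + 1)
  rw [zero_add] at this
  refine this.congr' ?_
  filter_upwards [hpos] with n hn
  have hn' : (x n : ℝ) ≠ 0 := by exact_mod_cast hn.ne'
  have hc := c_mul_log hθ
  have hcp := (c_pos hθ).ne'
  simp only [Function.comp_def, intensity]
  rw [Real.log_div hn' (by positivity), Real.log_mul (Real.exp_pos _).ne' (zpow_pos hq0 _).ne',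
    Real.log_exp, Real.log_zpow]
  push_cast
  have : c θ * (z / c θ) = z := by field_simp
  linear_combination (-((n : ℝ) - 1)) * hc - this

theorem c_mul_log_sub {θ : ℝ} (hθ : θ ∈ Set.Ioo (0 : ℝ) 1) {j : ℕ} (hj : 0 < j) (k : ℕ) :
    c θ * Real.log j - k = c θ * Real.log (j * (1 - θ) ^ k) := by
  have hq0 : 0 < 1 - θ := by linarith [hθ.2]
  have hj' : (j : ℝ) ≠ 0 := by exact_mod_cast hj.ne'
  rw [Real.log_mul hj' (by positivity), Real.log_pow]
  linear_combination (-(k : ℝ)) * c_mul_log hθ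

/-- Convergence of `c(θ) log j_k - k` in terms of `j_k (1 - θ)^k`. -/
theorem tendsto_c_mul_log_iff {θ : ℝ} (hθ : θ ∈ Set.Ioo (0 : ℝ) 1) {j : ℕ → ℕ}
    (hj : ∀ k, 1 ≤ k → 0 < j k) (z : ℝ) :
    Tendsto (fun k : ℕ => c θ * Real.log (j k) - k) atTop (𝓝 z) ↔
      Tendsto (fun k => (j k : ℝ) * (1 - θ) ^ k) atTop (𝓝 (Real.exp (z / c θ))) := by
  have hq0 : 0 < 1 - θ := by linarith [hθ.2]
  have hcp := c_pos hθ
  have heq : (fun k : ℕ => c θ * Real.log (j k) - k) =ᶠ[atTop]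
      fun k => c θ * Real.log (j k * (1 - θ) ^ k) := by
    filter_upwards [eventually_ge_atTop 1] with k hk using c_mul_log_sub hθ (hj k hk) k
  rw [tendsto_congr' heq]
  constructor
  · intro h
    have h1 := (Real.continuous_exp.tendsto _).comp (h.div_const (c θ))
    refine h1.congr' ?_
    filter_upwards [eventually_ge_atTop 1] with k hk
    have : (0 : ℝ) < j k := by exact_mod_cast hj k hk
    simp only [Function.comp_def]
    rw [mul_div_cancel_left₀ _ hcp.ne', Real.exp_log (by positivity)]
  · intro h
    have h1 := (((Real.continuousAt_log (Real.exp_pos _).ne').tendsto).comp h).const_mul (c θ)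
    rw [Real.log_exp, mul_div_cancel₀ _ hcp.ne'] at h1
    exact h1

theorem tendsto_c_mul_log_atBot_iff {θ : ℝ} (hθ : θ ∈ Set.Ioo (0 : ℝ) 1) {j : ℕ → ℕ}
    (hj : ∀ k, 1 ≤ k → 0 < j k) :
    Tendsto (fun k : ℕ => c θ * Real.log (j k) - k) atTop atBot ↔
      Tendsto (fun k => (j k : ℝ) * (1 - θ) ^ k) atTop (𝓝 0) := by
  have hq0 : 0 < 1 - θ := by linarith [hθ.2]
  have hcp := c_pos hθ
  have hjpos : ∀ᶠ k in atTop, (0 : ℝ) < j k * (1 - θ) ^ k := by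
    filter_upwards [eventually_ge_atTop 1] with k hk
    have : (0 : ℝ) < j k := by exact_mod_cast hj k hk
    positivity
  have heq : (fun k : ℕ => c θ * Real.log (j k) - k) =ᶠ[atTop]
      fun k => c θ * Real.log (j k * (1 - θ) ^ k) := by
    filter_upwards [eventually_ge_atTop 1] with k hk using c_mul_log_sub hθ (hj k hk) k
  rw [tendsto_congr' heq, tendsto_const_mul_atBot_of_pos hcp]
  constructor
  · intro h
    refine (Real.tendsto_exp_atBot.comp h).congr' ?_
    filter_upwards [hjpos] with k hk using Real.exp_log hk
  · intro h
    refine Real.tendsto_log_nhdsGT_zero.comp (tendsto_nhdsWithin_iff.2 ⟨h, hjpos⟩)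

/-! ### The limit laws and the main theorem. -/

/-- The value `lam = 0` is admitted so that the zero law belongs to the same family and
`tendsto_startLaw` covers it too. -/
theorem exists_limit_law {θ : ℝ} (hθ : θ ∈ Set.Ioo (0 : ℝ) 1) {lam : ℝ} (hlam : 0 ≤ lam) :
    ∃ P : ProbabilityMeasure (ℤ → ℕ), IsTwoSidedChain θ P ∧
      ∀ n b, (P : Measure (ℤ → ℕ)).real {x | x n = b} =
        poissonWeight (intensity θ lam n) b := by
  have hq0 : 0 < 1 - θ := by linarith [hθ.2]
  have hq1 : 1 - θ < 1 := by linarith [hθ.1]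
  have hnn : ∀ n, 0 ≤ intensity θ lam n := fun n => by unfold intensity; positivity
  have hsucc : ∀ n, intensity θ lam (n + 1) = intensity θ lam n * (1 - θ) := by
    intro n
    rw [intensity, intensity, show n + 1 - 1 = n - 1 + 1 by ring, zpow_add_one₀ hq0.ne', mul_assoc]
  refine exists_poisson_chain (θ := θ)
    (r := fun n => ⟨intensity θ lam n * θ, mul_nonneg (hnn n) hθ.1.le⟩)
    (L := fun n => ⟨intensity θ lam n, hnn n⟩) ?_ ?_ (fun n => rfl) hsucc
  · intro n
    refine NNReal.eq ?_
    change intensity θ lam n = intensity θ lam n * θ + intensity θ lam (n + 1)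
    rw [hsucc]; ring
  · refine NNReal.tendsto_coe.1 ?_
    change Tendsto (fun n => intensity θ lam n) atTop (𝓝 0)
    have hpow : Tendsto (fun n : ℤ => lam * (1 - θ) ^ (n - 1).toNat) atTop (𝓝 (lam * 0)) := by
      refine ((tendsto_pow_atTop_nhds_zero_of_lt_one hq0.le hq1).comp ?_).const_mul lam
      refine tendsto_atTop.2 fun N => ?_
      filter_upwards [eventually_ge_atTop ((N : ℤ) + 1)] with n hn
      omega
    rw [mul_zero] at hpow
    refine hpow.congr' ?_
    filter_upwards [eventually_ge_atTop (1 : ℤ)] with n hn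
    rw [intensity, ← zpow_natCast, Int.toNat_of_nonneg (by omega)]

theorem eq_zeroLaw {θ : ℝ} {P : ProbabilityMeasure (ℤ → ℕ)}
    (hm : ∀ n b, (P : Measure (ℤ → ℕ)).real {x | x n = b} =
      poissonWeight (intensity θ 0 n) b) : P = zeroLaw := by
  have h : ∀ n : ℤ, ∀ᵐ x ∂(P : Measure (ℤ → ℕ)), x n = 0 := by
    intro n
    have h1 : (P : Measure (ℤ → ℕ)).real {x | x n = 0} = 1 := by
      rw [hm]; simp [intensity, poissonWeight]
    have h2 := probReal_compl_eq_one_sub (μ := (P : Measure (ℤ → ℕ))) (measurableSet_coord n 0)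
    rw [h1, sub_self, measureReal_eq_zero_iff] at h2
    exact h2
  have hae : (fun x : ℤ → ℕ => x) =ᵐ[(P : Measure (ℤ → ℕ))] fun _ => fun _ => 0 := by
    filter_upwards [ae_all_iff.2 h] with x hx
    exact funext hx
  refine Subtype.ext ?_
  change (P : Measure (ℤ → ℕ)) = Measure.dirac fun _ => 0
  have : (P : Measure (ℤ → ℕ)).map (fun x => x) = (P : Measure (ℤ → ℕ)).map fun _ => fun _ => 0 :=
    Measure.map_congr hae
  rw [Measure.map_const, measure_univ, one_smul] at this
  rw [← this]
  exact Measure.map_id.symm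

/-- The state 0 at time 1 has probability exp(-lam) < 1. -/
theorem ne_zeroLaw {θ lam : ℝ} (hlam : 0 < lam) {P : ProbabilityMeasure (ℤ → ℕ)}
    (hm : ∀ n b, (P : Measure (ℤ → ℕ)).real {x | x n = b} =
      poissonWeight (intensity θ lam n) b) : P ≠ zeroLaw := by
  rintro rfl
  have h := hm 1 0
  have h1 : ((zeroLaw : ProbabilityMeasure (ℤ → ℕ)) : Measure (ℤ → ℕ)).real {x | x 1 = 0} = 1 := by
    change (Measure.dirac (fun _ : ℤ => (0 : ℕ))).real _ = 1
    rw [measureReal_def, Measure.dirac_apply' _ (measurableSet_coord 1 0)]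
    simp
  rw [h1] at h
  have h2 : Real.exp (-lam) < 1 := Real.exp_lt_one_iff.2 (by linarith)
  simp [poissonWeight, intensity] at h
  linarith

end Election

theorem theorem3 (θ : ℝ) (hθ : θ ∈ Set.Ioo (0 : ℝ) 1) :
    ∃ Plim : ℝ → ProbabilityMeasure (ℤ → ℕ),
      (∀ j : ℕ → ℕ, (∀ k, 1 ≤ k → 0 < j k) →
        -- weak convergence to a limit other than the point mass at the zero path
        ((∃ Q : ProbabilityMeasure (ℤ → ℕ), Q ≠ Election.zeroLaw ∧
            Tendsto (fun k => Election.startLaw θ hθ k (j k)) atTop (𝓝 Q)) ↔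
          ∃ z : ℝ, Tendsto (fun k : ℕ => Election.c θ * Real.log (j k) - k) atTop (𝓝 z)) ∧
        -- weak convergence to the point mass at the zero path
        (Tendsto (fun k => Election.startLaw θ hθ k (j k)) atTop (𝓝 Election.zeroLaw) ↔
          Tendsto (fun k : ℕ => Election.c θ * Real.log (j k) - k) atTop atBot) ∧
        -- the limit depends on the sequence only through `z`
        (∀ z : ℝ, Tendsto (fun k : ℕ => Election.c θ * Real.log (j k) - k) atTop (𝓝 z) →
          Tendsto (fun k => Election.startLaw θ hθ k (j k)) atTop (𝓝 (Plim z)))) ∧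
      ∀ z : ℝ,
        Election.IsTwoSidedChain θ (Plim z) ∧
        ∀ᵐ x ∂(Plim z : Measure (ℤ → ℕ)),
          (∀ᶠ n : ℤ in atBot, 0 < x n) ∧
          Tendsto (fun n : ℤ => Election.c θ * Real.log (x n) + n) atBot (𝓝 (z + 1)) := by
  choose P hchain hmarg using fun z : ℝ =>
    Election.exists_limit_law hθ (Real.exp_pos (z / Election.c θ)).le
  obtain ⟨P₀, hchain₀, hmarg₀⟩ := Election.exists_limit_law hθ le_rfl
  have hP₀ : P₀ = Election.zeroLaw := Election.eq_zeroLaw hmarg₀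
  subst hP₀
  have hcp := Election.c_pos hθ
  refine ⟨P, fun j hj => ?_, fun z => ⟨hchain z, Election.ae_tendsto_log hθ z (hmarg z)⟩⟩
  have hlim : ∀ z : ℝ, Tendsto (fun k : ℕ => Election.c θ * Real.log (j k) - k) atTop (𝓝 z) →
      Tendsto (fun k => Election.startLaw θ hθ k (j k)) atTop (𝓝 (P z)) := fun z hz =>
    Election.tendsto_startLaw hθ (hchain z) (hmarg z) ((Election.tendsto_c_mul_log_iff hθ hj z).1 hz)
  have hpos : ∀ lam : ℝ, 0 < lam →
      Tendsto (fun k => (j k : ℝ) * (1 - θ) ^ k) atTop (𝓝 lam) →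
      Tendsto (fun k : ℕ => Election.c θ * Real.log (j k) - k) atTop
        (𝓝 (Election.c θ * Real.log lam)) := by
    intro lam hl h
    refine (Election.tendsto_c_mul_log_iff hθ hj _).2 ?_
    rwa [mul_div_cancel_left₀ _ hcp.ne', Real.exp_log hl]
  refine ⟨⟨?_, ?_⟩, ⟨?_, ?_⟩, hlim⟩
  · rintro ⟨Q, hQ0, hQ⟩
    -- The limit lam of the means determines the weak limit; lam = 0 would make it the zero law by
    -- uniqueness of limits.
    obtain ⟨lam, hlam, h⟩ := Election.exists_tendsto_of_tendsto_startLaw hθ hQ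
    rcases hlam.eq_or_lt with rfl | hl
    · exact absurd (tendsto_nhds_unique hQ (Election.tendsto_startLaw hθ hchain₀ hmarg₀ h)) hQ0
    · exact ⟨_, hpos lam hl h⟩
  · rintro ⟨z, hz⟩
    exact ⟨P z, Election.ne_zeroLaw (Real.exp_pos _) (hmarg z), hlim z hz⟩
  · intro hQ
    obtain ⟨lam, hlam, h⟩ := Election.exists_tendsto_of_tendsto_startLaw hθ hQ
    rcases hlam.eq_or_lt with rfl | hl
    · exact (Election.tendsto_c_mul_log_atBot_iff hθ hj).2 h
    · exact absurd (tendsto_nhds_unique hQ (hlim _ (hpos lam hl h))).symm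
        (Election.ne_zeroLaw (Real.exp_pos _) (hmarg _))
  · intro h
    exact Election.tendsto_startLaw hθ hchain₀ hmarg₀
      ((Election.tendsto_c_mul_log_atBot_iff hθ hj).1 h)
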